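/- Conventions. Structures are relational, with arbitrary (possibly infinite) signatures and nonempty domains; operations have arity $n\ge 1$. An at most countable structure $\mathbb A$ is *$\omega$-categorical* if for every $n\ge 1$ the componentwise action of $\mathrm{Aut}(\mathbb A)$ on $A^n$ has finitely many orbits. A *pp-formula* over $\mathbb A$ is a first-order formula built from relation symbols of $\mathbb A$ and equality using conjunction and existential quantification; a relation is *pp-definable* in $\mathbb A$ if it is defined by a pp-formula without parameters. A $k$-ary relation on $A^n$ is regarded as a $kn$-ary relation on $A$. * $\mathbb A$ *pp-interprets* $\mathbb B$ if for some $n\ge 1$ there is a map $f$ from a subset of $A^n$ onto $B$ such that the domain of $f$, and the $f$-preimages of equality on $B$ and of every relation of $\mathbb B$, are pp-definable in $\mathbb A$. * A *pp-power* of $\mathbb A$ is a structure isomorphic to one with domain $A^n$, $n\geq 1$, all of whose relations are pp-definable in $\mathbb A$. * Two structures of the same signature are *homomorphically equivalent* if there are homomorphisms between them in both directions. * A *model-complete core* is a structure $\mathbb C$ such that for every endomorphism $e$ and every finite $F\subseteq C$ some automorphism agrees with $e$ on $F$. * $\mathbb B$ is *pp-constructible* from $\mathbb A$ if there is a finite sequence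 $\mathbb A=\mathbb C_1,\dots,\mathbb C_k=\mathbb B$ such that for each $i<k$: $\mathbb C_i$ pp-interprets $\mathbb C_{i+1}$; or $\mathbb C_i$ and $\mathbb C_{i+1}$ are homomorphically equivalent; or $\mathbb C_i$ is an at most countable $\omega$-categorical model-complete core and $\mathbb C_{i+1}$ is obtained from it by adding one singleton unary relation. * $\mathrm{Pol}(\mathbb A)$ is the set of all finitary operations on $A$ preserving all relations of $\mathbb A$. For classes $K$ of sets of finitary operations (up to renaming elements of the domain): $\mathrm{P}_{\mathrm{fin}}K$ consists of the componentwise actions of members of $K$ on finite powers of their domains; $\mathrm{R}K$ consists of the *reflections* of members $F$ of $K$, i.e. the sets $\{(x_1,\dots,x_n)\mapsto h_2(f(h_1(x_1),\dots,h_1(x_n))) : f\in F\}$ of operations on a set $Y$, where $F$ is a set of operations on $X$ and $h_1:Y\to X$, $h_2:X\to Y$ are arbitrary maps; $\mathrm{E}K$ consists of the sets of operations obtained from members of $K$ by adding operations on the same domain. * An *h1 clone homomorphism* is an arity-preserving map $\xi:\mathrm{Pol}(\mathbb A)\to\mathrm{Pol}(\mathbb B)$ with $\xi(f(\pi^m_{i_1},\dots,\pi^m_{i_n}))=\xi(f)(\pi^m_{i_1},\dots,\pi^m_{i_n})$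 for all $m,n\ge1$, all $n$-ary $f\in\mathrm{Pol}(\mathbb A)$ and all $i_1,\dots,i_n\in\{1,\dots,m\}$, where $\pi^m_i$ denotes the $m$-ary projection to the $i$-th coordinate. It is *uniformly continuous* if for every finite $B'\subseteq B$ there is a finite $A'\subseteq A$ such that whenever $f,g\in\mathrm{Pol}(\mathbb A)$ of the same arity agree on $A'$ (on all tuples of elements of $A'$), $\xi(f)$ and $\xi(g)$ agree on $B'$. **Theorem 1.5.** Let $\mathbb A$ be an at most countable $\omega$-categorical structure and $\mathbb B$ a finite structure. Assume that all relations of $\mathbb B$ are nonempty, or that the empty unary relation is pp-definable in $\mathbb A$. Then the following are equivalent: 1. (i) $\mathbb B$ is homomorphically equivalent to a pp-power of $\mathbb A$; 2. (i') $\mathbb B$ is pp-constructible from $\mathbb A$; 3. (ii) $\mathrm{Pol}(\mathbb B)\in \mathrm{E}\,\mathrm{R}\,\mathrm{P}_{\mathrm{fin}}\{\mathrm{Pol}(\mathbb A)\}$; 4. (iii) there is a uniformly continuous h1 clone homomorphism $\mathrm{Pol}(\mathbb A)\to\mathrm{Pol}(\mathbb B)$. -/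

import Mathlib

open FirstOrder FirstOrder.Language.Structure

universe u v w

/-! ### Relational structures -/

/-- A relational structure: a signature without function symbols, a domain, and an interpretation
of every relation symbol. -/
structure RelStructure where
  L : FirstOrder.Language.{v, w}
  [isRelational : L.IsRelational]
  carrier : Type u
  [str : L.Structure carrier]

namespace RelStructure

attribute [instance] RelStructure.isRelational RelStructure.str

instance : CoeSort RelStructure.{u, v, w} (Type u) := ⟨RelStructure.carrier⟩

/-- `ω`-categoricity of an at most countable structure: for every `n ≥ 1` the componentwise action
of the automorphism group on `n`-tuples has only finitely many orbits, i.e. finitely many tuples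
represent all orbits. -/
def OmegaCategorical (A : RelStructure.{u, v, w}) : Prop :=
  ∀ n : ℕ, 1 ≤ n → ∃ S : Set (Fin n → A), S.Finite ∧
    ∀ x : Fin n → A, ∃ y ∈ S, ∃ g : A ≃[A.L] A, ∀ i, g (y i) = x i

/-- The automorphisms are dense in the endomorphisms. -/
def IsModelCompleteCore (A : RelStructure.{u, v, w}) : Prop :=
  ∀ (e : A →[A.L] A) (F : Set A), F.Finite → ∃ g : A ≃[A.L] A, ∀ a ∈ F, g a = e a

/-- Primitive positive formulas: built from equalities and predicates of the signature with
conjunction and existential quantification. -/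
inductive IsPP {L : FirstOrder.Language.{v, w}} {ι : Type} : ∀ {n : ℕ}, L.BoundedFormula ι n → Prop
  | equal {n : ℕ} (t₁ t₂ : L.Term (ι ⊕ Fin n)) : IsPP (t₁.bdEqual t₂)
  | rel {n k : ℕ} (R : L.Relations k) (ts : Fin k → L.Term (ι ⊕ Fin n)) :
      IsPP (R.boundedFormula ts)
  | inf {n : ℕ} {φ ψ : L.BoundedFormula ι n} : IsPP φ → IsPP ψ → IsPP (φ ⊓ ψ)
  | ex {n : ℕ} {φ : L.BoundedFormula ι (n + 1)} : IsPP φ → IsPP φ.ex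

/-- A relation on `A`, with coordinates indexed by `ι`, is pp-definable in `A` if it is defined by
a pp-formula without parameters. -/
def PPDefinable (A : RelStructure.{u, v, w}) {ι : Type} (S : Set (ι → A)) : Prop :=
  ∃ φ : A.L.Formula ι, IsPP φ ∧ S = {x | φ.Realize x}

/-- `A` pp-interprets `B`: there are `n ≥ 1` and a partial map `f` from `A ^ n` onto `B` such that
the domain of `f`, and the preimages of equality and of all the relations of `B`, are pp-definable
in `A`. A `k`-ary relation on `A ^ n` is regarded as a relation on `A` with coordinates indexed by
`Fin k × Fin n`. -/
def PPInterprets (A B : RelStructure.{u, v, w}) : Prop :=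
  ∃ n : ℕ, 1 ≤ n ∧ ∃ f : (Fin n → A) →. B,
    (∀ b : B, ∃ x, b ∈ f x) ∧
    A.PPDefinable f.Dom ∧
    A.PPDefinable {x : Fin 2 × Fin n → A |
      ∃ b : B, b ∈ f (fun j => x (0, j)) ∧ b ∈ f (fun j => x (1, j))} ∧
    ∀ (k : ℕ) (R : B.L.Relations k), A.PPDefinable {x : Fin k × Fin n → A |
      ∃ b : Fin k → B, (∀ i, b i ∈ f (fun j => x (i, j))) ∧ RelMap R b}

/-- `B` is a pp-power of `A`: it is isomorphic, via `e`, to a structure with domain `A ^ n`,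
`n ≥ 1`, all of whose relations are pp-definable in `A`. -/
def IsPPPower (B A : RelStructure.{u, v, w}) : Prop :=
  ∃ n : ℕ, 1 ≤ n ∧ ∃ e : (Fin n → A) ≃ B,
    ∀ (k : ℕ) (R : B.L.Relations k), A.PPDefinable {x : Fin k × Fin n → A |
      RelMap R (fun i => e (fun j => x (i, j)))}

/-- Homomorphic equivalence of relational structures; in particular, they have the same
signature. -/
inductive HomEquiv : RelStructure.{u, v, w} → RelStructure.{u, v, w} → Prop
  | mk (L : FirstOrder.Language.{v, w}) [L.IsRelational] (M N : Type u) [L.Structure M] [L.Structure N]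
      (f : M →[L] N) (g : N →[L] M) : HomEquiv ⟨L, M⟩ ⟨L, N⟩

/-- The only symbol of the signature `unaryLanguage`. -/
inductive UnarySymbol : ℕ → Type w
  | mk : UnarySymbol 1

/-- The signature with a single relation symbol, which is unary. -/
def unaryLanguage : FirstOrder.Language.{v, w} := ⟨fun _ => PEmpty, UnarySymbol⟩

instance : unaryLanguage.{v, w}.IsRelational := fun _ => inferInstanceAs (IsEmpty PEmpty)

/-- The interpretation of the unary symbol as the singleton `{s}`. -/
@[reducible]
def singletonStructure {M : Type u} (s : M) : unaryLanguage.{v, w}.Structure M where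
  funMap f := f.elim
  RelMap
    | .mk => fun x => x 0 = s

/-- The expansion of `A` by one further unary relation, which is the singleton `{s}`. -/
def addSingleton (A : RelStructure.{u, v, w}) (s : A) : RelStructure.{u, v, w} :=
  letI := singletonStructure.{u, v, w} s
  { L := A.L.sum unaryLanguage.{v, w}
    carrier := A }

/-- One step of a pp-construction. -/
inductive PPStep : RelStructure.{u, v, w} → RelStructure.{u, v, w} → Prop
  | interpretation {C D : RelStructure.{u, v, w}} : PPInterprets C D → PPStep C D
  | homEquiv {C D : RelStructure.{u, v, w}} : HomEquiv C D → PPStep C D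
  | singleton (C : RelStructure.{u, v, w}) (s : C) : Countable C → C.OmegaCategorical →
      C.IsModelCompleteCore → PPStep C (C.addSingleton s)

/-- `B` can be pp-constructed from `A` (by a finite, possibly empty, sequence of steps). -/
def PPConstructs (A B : RelStructure.{u, v, w}) : Prop :=
  Relation.ReflTransGen PPStep A B

end RelStructure

/-! ### Sets of functions and function clones -/

/-- A set of finitary operations, of arities `n ≥ 1`, on a domain. -/
structure FunctionSet where
  dom : Type u
  ops : ∀ n : ℕ+, Set ((Fin n → dom) → dom)

namespace FunctionSet

/-- `F` and `G` are equal up to renaming the elements of the domain. -/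
def IsRenaming (F G : FunctionSet.{u}) : Prop :=
  ∃ e : F.dom ≃ G.dom, ∀ n : ℕ+,
    G.ops n = {g | ∃ f ∈ F.ops n, g = fun x => e (f fun i => e.symm (x i))}

/-- The componentwise action of `F` on the `m`-th power of its domain. -/
def power (F : FunctionSet.{u}) (m : ℕ) : FunctionSet.{u} where
  dom := Fin m → F.dom
  ops n := {g | ∃ f ∈ F.ops n, g = fun x j => f fun i => x i j}

/-- The operator `P_fin`: componentwise actions on finite powers, up to renaming. -/
def finitePowers (K : Set FunctionSet.{u}) : Set FunctionSet.{u} :=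
  {G | ∃ F ∈ K, ∃ m : ℕ, IsRenaming (F.power m) G}

/-- The operator `R`: for maps `h₁ : B → A` and `h₂ : A → B`, the reflection of a set of
functions on `A` consists of the functions `h₂ (f (h₁ x₁, …, h₁ xₙ))`. -/
def reflections (K : Set FunctionSet.{u}) : Set FunctionSet.{u} :=
  {G | ∃ F ∈ K, ∃ (h₁ : G.dom → F.dom) (h₂ : F.dom → G.dom), ∀ n : ℕ+,
    G.ops n = {g | ∃ f ∈ F.ops n, g = fun x => h₂ (f fun i => h₁ (x i))}}

/-- The operator `E`: sets of functions obtained by adding functions, up to renaming. -/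
def expansions (K : Set FunctionSet.{u}) : Set FunctionSet.{u} :=
  {G | ∃ F ∈ K, ∃ e : F.dom ≃ G.dom, ∀ n : ℕ+, ∀ f ∈ F.ops n,
    (fun x => e (f fun i => e.symm (x i))) ∈ G.ops n}

end FunctionSet

/-- A function clone: a set of finitary operations that contains all projections and is closed
under composition. -/
structure FunctionClone extends FunctionSet.{u} where
  proj_mem : ∀ (n : ℕ+) (i : Fin n), (fun x => x i) ∈ ops n
  comp_mem : ∀ {n m : ℕ+} {f : (Fin n → dom) → dom} {g : Fin n → (Fin m → dom) → dom},
    f ∈ ops n → (∀ i, g i ∈ ops m) → (fun x => f fun i => g i x) ∈ ops m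

namespace FunctionClone

/-- The `n`-ary projection onto the `i`-th coordinate. -/
def proj (C : FunctionClone.{u}) (n : ℕ+) (i : Fin n) : C.ops n :=
  ⟨fun x => x i, C.proj_mem n i⟩

/-- The composition `f (g₁, …, gₙ)`. -/
def comp (C : FunctionClone.{u}) {n m : ℕ+} (f : C.ops n) (g : Fin n → C.ops m) : C.ops m :=
  ⟨fun x => f.1 fun i => (g i).1 x, C.comp_mem f.2 fun i => (g i).2⟩

/-- An arity preserving map between function clones. -/
abbrev ArityMap (C D : FunctionClone.{u}) := ∀ n : ℕ+, C.ops n → D.ops n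

/-- `ξ` is an h1 clone homomorphism (it preserves identities of height 1):
`ξ (f (π_{σ 1}, …, π_{σ n})) = ξ f (π_{σ 1}, …, π_{σ n})`. -/
def IsH1Hom {C D : FunctionClone.{u}} (ξ : ArityMap C D) : Prop :=
  ∀ (n m : ℕ+) (σ : Fin n → Fin m) (f : C.ops n),
    ξ m (C.comp f fun i => C.proj m (σ i)) = D.comp (ξ n f) fun i => D.proj m (σ i)

/-- Two functions of the same arity agree on the subset `S` of the domain. -/
def AgreeOn {X : Type u} {n : ℕ+} (f g : (Fin n → X) → X) (S : Set X) : Prop :=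
  ∀ x : Fin n → X, (∀ i, x i ∈ S) → f x = g x

/-- Uniform continuity with respect to the uniformity of pointwise convergence. -/
def IsUniformlyContinuous {C D : FunctionClone.{u}} (ξ : ArityMap C D) : Prop :=
  ∀ T : Set D.dom, T.Finite → ∃ S : Set C.dom, S.Finite ∧
    ∀ (n : ℕ+) (f g : C.ops n), AgreeOn f.1 g.1 S → AgreeOn (ξ n f).1 (ξ n g).1 T

end FunctionClone

/-- The polymorphism clone of `A`: all the finitary operations that preserve every relation. -/
def RelStructure.Pol (A : RelStructure.{u, v, w}) : FunctionClone.{u} where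
  dom := A
  ops n := {f | ∀ (k : ℕ) (R : A.L.Relations k) (t : Fin n → Fin k → A),
    (∀ i, RelMap R (t i)) → RelMap R fun j => f fun i => t i j}
  proj_mem _ i _ _ _ ht := ht i
  comp_mem hf hg k R t ht := hf k R _ fun i => hg i k R t ht

/-!
Conditions (i) and (ii) are witnessed by the same data, a pair of maps `B → A ^ I → B` with `I`
finite: by pp-definability of relations in the one case, by reflection of polymorphisms in the
other. Relations lead to polymorphisms because polymorphisms preserve pp-definable relations.
Conversely, the relation to be defined is the closure of finitely many tuples under the
polymorphisms of `A`, that is, a projection of the solution set of an infinite system of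
constraints. As `A` is `ω`-categorical, finitely many of the constraints already determine the
projection, because among the finitely many relations invariant under automorphisms there is no
infinite descending chain; as `A` is countable, any finite partial solution that is compatible with
every finite part of the system extends to a solution.

A uniformly continuous h1 clone homomorphism `ξ` into operations on a finite set is a reflection:
the value of `ξ f` at an enumeration of the target depends only on `f` restricted to a finite set.
-/

/-- The operations in `F` preserve the relation `S`. -/
def FunctionSet.Preserves (F : FunctionSet.{u}) {ι : Type} (S : Set (ι → F.dom)) : Prop :=
  ∀ n : ℕ+, ∀ f ∈ F.ops n, ∀ t : Fin n → ι → F.dom,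
    (∀ i, t i ∈ S) → (fun j => f fun i => t i j) ∈ S

namespace RelStructure

/-! ### Closure properties of pp-definable relations -/

section Formulas

variable {L : FirstOrder.Language.{v, w}} {ι κ : Type}

theorem IsPP.castLE {m : ℕ} {φ : L.BoundedFormula ι m} (hφ : IsPP φ) :
    ∀ {n : ℕ} (h : m ≤ n), IsPP (φ.castLE h) := by
  induction hφ with
  | equal t₁ t₂ => exact fun _ => .equal _ _
  | rel R ts => exact fun _ => .rel R _
  | inf _ _ ih₁ ih₂ => exact fun h => .inf (ih₁ h) (ih₂ h)
  | ex _ ih => exact fun h => .ex (ih (Nat.add_le_add_right h 1))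

theorem IsPP.relabel {m n : ℕ} {φ : L.BoundedFormula ι m} (hφ : IsPP φ) (σ : ι → κ ⊕ Fin n) :
    IsPP (φ.relabel σ) := by
  induction hφ with
  | equal t₁ t₂ => exact .equal _ _
  | rel R ts => exact .rel R _
  | inf _ _ ih₁ ih₂ => exact .inf ih₁ ih₂
  | ex _ ih => exact .ex (ih.castLE _)

theorem IsPP.exs : ∀ {n : ℕ} {φ : L.BoundedFormula ι n}, IsPP φ → IsPP φ.exs
  | 0, _, hφ => hφ
  | _ + 1, φ, hφ => IsPP.exs (φ := φ.ex) hφ.ex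

theorem exists_eq_var_of_isRelational [L.IsRelational] (t : L.Term ι) : ∃ a, t = .var a := by
  cases t with
  | var a => exact ⟨a, rfl⟩
  | func f _ => exact isEmptyElim f

end Formulas

section PPDefinable

variable {A : RelStructure.{u, v, w}} {ι κ : Type}

theorem PPDefinable.preimage {S : Set (ι → A)} (hS : A.PPDefinable S) (σ : ι → κ) :
    A.PPDefinable {y : κ → A | (fun i => y (σ i)) ∈ S} := by
  obtain ⟨φ, hφ, rfl⟩ := hS
  refine ⟨Language.Formula.relabel σ φ, hφ.relabel _, ?_⟩
  ext y
  exact Language.Formula.realize_relabel.symm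

theorem PPDefinable.inter {S T : Set (ι → A)} :
    A.PPDefinable S → A.PPDefinable T → A.PPDefinable (S ∩ T) := by
  rintro ⟨φ, hφ, rfl⟩ ⟨ψ, hψ, rfl⟩
  refine ⟨_, hφ.inf hψ, ?_⟩
  ext x
  exact Language.Formula.realize_inf.symm

theorem PPDefinable.exists [Finite κ] {S : Set (ι ⊕ κ → A)} (hS : A.PPDefinable S) :
    A.PPDefinable {x | ∃ y, Sum.elim x y ∈ S} := by
  obtain ⟨φ, hφ, rfl⟩ := hS
  refine ⟨φ.iExs κ, (hφ.relabel _).exs, ?_⟩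
  ext x
  exact Language.Formula.realize_iExs.symm

theorem ppDefinable_eq (a b : ι) : A.PPDefinable {x : ι → A | x a = x b} :=
  ⟨_, .equal (.var (.inl a)) (.var (.inl b)), by simp [Language.Formula.Realize]⟩

theorem ppDefinable_rel {k : ℕ} (R : A.L.Relations k) (t : Fin k → ι) :
    A.PPDefinable {x : ι → A | RelMap R fun i => x (t i)} :=
  ⟨_, .rel R fun i => .var (.inl (t i)), by
    simp [Language.Formula.Realize, Language.BoundedFormula.realize_rel]⟩

theorem ppDefinable_univ [Nonempty A] : A.PPDefinable (Set.univ : Set (ι → A)) := by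
  convert (ppDefinable_eq (A := A) (Sum.inr () : ι ⊕ Unit) (.inr ())).exists using 1
  simp

theorem PPDefinable.empty [Finite ι] (h : A.PPDefinable (∅ : Set (ι → A))) :
    A.PPDefinable (∅ : Set (κ → A)) := by
  convert (h.preimage (Sum.inr : ι → κ ⊕ ι)).exists using 1
  simp

theorem ppDefinable_forall [Nonempty A] {J : Type*} [Finite J] {S : J → Set (ι → A)}
    (hS : ∀ j, A.PPDefinable (S j)) : A.PPDefinable {x | ∀ j, x ∈ S j} := by
  cases nonempty_fintype J
  suffices ∀ s : Finset J, A.PPDefinable {x | ∀ j ∈ s, x ∈ S j} by simpa using this Finset.univ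
  intro s
  induction s using Finset.cons_induction with
  | empty => simpa using ppDefinable_univ
  | cons a s ha ih =>
    convert (hS a).inter ih using 1
    ext x
    simp

theorem PPDefinable.induction {motive : ∀ {ι : Type}, Set (ι → A) → Prop}
    (eq : ∀ {ι : Type} (a b : ι), motive {x | x a = x b})
    (rel : ∀ {ι : Type} {k : ℕ} (R : A.L.Relations k) (t : Fin k → ι),
      motive {x | RelMap R fun i => x (t i)})
    (inter : ∀ {ι : Type} {S T : Set (ι → A)}, motive S → motive T → motive (S ∩ T))
    (preimage : ∀ {ι κ : Type} {S : Set (ι → A)} (σ : ι → κ), motive S →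
      motive {y : κ → A | (fun i => y (σ i)) ∈ S})
    (exists_unit : ∀ {ι : Type} {S : Set (ι ⊕ Unit → A)}, motive S →
      motive {x : ι → A | ∃ y, Sum.elim x y ∈ S})
    {S : Set (ι → A)} (hS : A.PPDefinable S) : motive S := by
  have key {n : ℕ} {φ : A.L.BoundedFormula ι n} (hφ : IsPP φ) :
      motive {z : ι ⊕ Fin n → A | φ.Realize (fun i => z (.inl i)) (fun j => z (.inr j))} := by
    induction hφ with
    | equal t₁ t₂ =>
      obtain ⟨a, rfl⟩ := exists_eq_var_of_isRelational t₁
      obtain ⟨b, rfl⟩ := exists_eq_var_of_isRelational t₂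
      convert eq a b using 1
      ext z
      simp [← Function.comp_def]
    | rel R ts =>
      choose t ht using fun i => exists_eq_var_of_isRelational (ts i)
      obtain rfl : ts = fun i => .var (t i) := funext ht
      convert rel R t using 1
      ext z
      simp [Language.BoundedFormula.realize_rel, ← Function.comp_def]
    | inf _ _ ih₁ ih₂ =>
      convert inter ih₁ ih₂ using 1
      ext z
      exact Language.BoundedFormula.realize_inf
    | @ex n φ _ ih =>
      let σ : ι ⊕ Fin (n + 1) → (ι ⊕ Fin n) ⊕ Unit :=
        Sum.elim (fun i => .inl (.inl i)) (Fin.snoc (fun j => .inl (.inr j)) (.inr ()))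
      convert exists_unit (preimage σ ih) using 1
      ext z
      have hσ (y : Unit → A) : (fun j => Sum.elim z y (σ (.inr j))) =
          Fin.snoc (fun j => z (.inr j)) (y ()) := by
        ext j
        induction j using Fin.lastCases <;> simp [σ]
      simp only [Set.mem_ofPred_eq, Language.BoundedFormula.realize_ex, hσ]
      exact (Equiv.funUnique Unit A).symm.exists_congr_left
  obtain ⟨φ, hφ, rfl⟩ := hS
  convert preimage (Sum.elim id Fin.elim0) (key hφ) using 1
  ext x
  exact iff_of_eq (congrArg (Language.BoundedFormula.Realize φ x) (Subsingleton.elim _ _))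

theorem PPDefinable.preserves_pol {S : Set (ι → A)} (hS : A.PPDefinable S) :
    A.Pol.Preserves S := by
  intro n f hf
  refine hS.induction (motive := fun S => ∀ t : Fin n → _ → A, (∀ i, t i ∈ S) →
    (fun j => f fun i => t i j) ∈ S) ?eq ?rel ?inter ?preimage ?exists_unit
  case eq => exact fun a b t ht => congrArg f (funext ht)
  case rel => exact fun R s t ht => hf _ R (fun i j => t i (s j)) ht
  case inter => exact fun ih₁ ih₂ t ht => ⟨ih₁ t fun i => (ht i).1, ih₂ t fun i => (ht i).2⟩
  case preimage => exact fun σ ih t ht => ih (fun i j => t i (σ j)) ht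
  case exists_unit =>
    intro ι S ih t ht
    choose y hy using ht
    refine ⟨fun j => f fun i => y i j, (congrArg (· ∈ S) (funext ?_)).mpr (ih _ hy)⟩
    rintro (j | j) <;> rfl

end PPDefinable

/-! ### Homomorphic equivalence with pp-powers -/

/-- The maps `h₁ : X → A ^ I` and `h₂ : A ^ I → X` *represent* a relation `S` on `X` if they are
homomorphisms between `S` and some relation on `A ^ I` that is pp-definable in `A`. -/
def PPRepresents (A : RelStructure.{u, v, w}) {X : Type*} {I : Type} (h₁ : X → I → A)
    (h₂ : (I → A) → X) {ι : Type} (S : Set (ι → X)) : Prop :=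
  ∃ S' : Set (ι × I → A), A.PPDefinable S' ∧ (∀ x ∈ S, (fun p => h₁ (x p.1) p.2) ∈ S') ∧
    ∀ y ∈ S', (fun i => h₂ fun j => y (i, j)) ∈ S

/-- `B` is homomorphically equivalent to a pp-power of `A`. -/
def HomEquivPPPower (B A : RelStructure.{u, v, w}) : Prop :=
  ∃ C : RelStructure.{u, v, w}, C.IsPPPower A ∧ B.HomEquiv C

section PPPower

variable {A B C : RelStructure.{u, v, w}}

theorem PPRepresents.of_ppDefinable [Nonempty A] {I : Type} [Finite I] {h₁ : B → I → A}
    {h₂ : (I → A) → B}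
    (hB : ∀ (k : ℕ) (R : B.L.Relations k), A.PPRepresents h₁ h₂ {x | RelMap R x})
    {ι : Type} {S : Set (ι → B)} (hS : B.PPDefinable S) : A.PPRepresents h₁ h₂ S := by
  refine hS.induction (motive := fun S => A.PPRepresents h₁ h₂ S)
    ?eq ?rel ?inter ?preimage ?exists_unit
  case eq =>
    intro ι a b
    exact ⟨{y | ∀ j, y (a, j) = y (b, j)}, ppDefinable_forall fun j => ppDefinable_eq _ _,
      fun x hx j => congrFun (congrArg h₁ hx) j, fun y hy => congrArg h₂ (funext hy)⟩
  case rel =>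
    intro ι k R t
    obtain ⟨S', hS', hto, hof⟩ := hB _ R
    exact ⟨_, hS'.preimage fun p => (t p.1, p.2), fun x hx => hto _ hx, fun y hy => hof _ hy⟩
  case inter =>
    rintro ι S T ⟨S', hS', hSto, hSof⟩ ⟨T', hT', hTto, hTof⟩
    exact ⟨_, hS'.inter hT', fun x hx => ⟨hSto x hx.1, hTto x hx.2⟩,
      fun y hy => ⟨hSof y hy.1, hTof y hy.2⟩⟩
  case preimage =>
    rintro ι κ S σ ⟨S', hS', hto, hof⟩
    exact ⟨_, hS'.preimage (Prod.map σ id), fun x hx => hto _ hx, fun y hy => hof _ hy⟩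
  case exists_unit =>
    rintro ι S ⟨S', hS', hto, hof⟩
    refine ⟨_, (hS'.preimage (Equiv.sumProdDistrib _ Unit I)).exists, ?_, ?_⟩
    · rintro x ⟨z, hz⟩
      refine ⟨fun p => h₁ (z p.1) p.2, ?_⟩
      rw [Set.mem_ofPred_eq]
      convert hto _ hz using 1
      ext ⟨i | i, j⟩ <;> rfl
    · rintro y ⟨z, hz⟩
      refine ⟨fun i => h₂ fun j => z (i, j), ?_⟩
      convert hof _ hz using 1
      ext (i | i) <;> rfl

theorem PPRepresents.trans [Nonempty A] {I J : Type} [Finite I] {h₁ : B → I → A}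
    {h₂ : (I → A) → B}
    (hB : ∀ (k : ℕ) (R : B.L.Relations k), A.PPRepresents h₁ h₂ {x | RelMap R x})
    {X : Type*} {g₁ : X → J → B} {g₂ : (J → B) → X} {ι : Type} {S : Set (ι → X)}
    (hS : B.PPRepresents g₁ g₂ S) :
    A.PPRepresents (fun x (p : J × I) => h₁ (g₁ x p.1) p.2)
      (fun y => g₂ fun j => h₂ fun i => y (j, i)) S := by
  obtain ⟨S', hS', hgto, hgof⟩ := hS
  obtain ⟨S'', hS'', hhto, hhof⟩ := PPRepresents.of_ppDefinable hB hS'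
  exact ⟨_, hS''.preimage (Equiv.prodAssoc ι J I), fun x hx => hhto _ (hgto x hx),
    fun y hy => hgof _ (hhof _ hy)⟩

theorem HomEquiv.symm (h : A.HomEquiv B) : B.HomEquiv A := by
  cases h with
  | mk L M N f g => exact .mk L N M g f

theorem homEquivPPPower_iff : B.HomEquivPPPower A ↔
    ∃ (I : Type) (_ : Finite I) (_ : Nonempty I) (h₁ : B → I → A) (h₂ : (I → A) → B),
      ∀ (k : ℕ) (R : B.L.Relations k), A.PPRepresents h₁ h₂ {x | RelMap R x} := by
  constructor
  · rintro ⟨C, ⟨n, hn, e, he⟩, hBC⟩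
    cases hBC with
    | mk L M N f g =>
      refine ⟨Fin n, inferInstance, ⟨0, hn⟩, fun b => e.symm (f b), fun x => g (e x),
        fun k R => ⟨_, he k R, fun x hx => ?_, fun y hy => g.map_rel R _ hy⟩⟩
      simpa [Function.comp_def] using f.map_rel R x hx
  · rintro ⟨I, _, _, h₁, h₂, hR⟩
    choose P hP hto hof using hR
    obtain ⟨n, ⟨e⟩⟩ := Finite.exists_equiv_fin I
    let S : B.L.Structure (Fin n → A) :=
      { funMap := fun f => isEmptyElim f
        RelMap := fun {k} R x => (fun p : Fin k × I => x p.1 (e p.2)) ∈ P k R }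
    refine ⟨⟨B.L, Fin n → A⟩, ⟨n, Fin.pos (e (Classical.arbitrary I)), Equiv.refl _,
      fun k R => ?_⟩,
      .mk B.L B (Fin n → A) ⟨fun b j => h₁ b (e.symm j), fun f => isEmptyElim f, fun R x hx => ?_⟩
        ⟨fun x => h₂ fun i => x (e i), fun f => isEmptyElim f, fun R x hx => ?_⟩⟩
    · exact (hP k R).preimage fun p : Fin k × I => (p.1, e p.2)
    · change (fun p : Fin _ × I => h₁ (x p.1) (e.symm (e p.2))) ∈ P _ R
      simpa only [Equiv.symm_apply_apply] using hto _ R x hx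
    · exact hof _ R _ hx

theorem HomEquivPPPower.of_homEquiv (h : A.HomEquiv B) : B.HomEquivPPPower A :=
  ⟨A, ⟨1, le_rfl, Equiv.funUnique (Fin 1) A, fun _ R => ppDefinable_rel R fun i => (i, 0)⟩, h.symm⟩

theorem HomEquivPPPower.refl (A : RelStructure.{u, v, w}) : A.HomEquivPPPower A :=
  .of_homEquiv (.mk A.L A A (.id A.L A) (.id A.L A))

theorem HomEquivPPPower.trans [Nonempty A] (hCB : C.HomEquivPPPower B)
    (hBA : B.HomEquivPPPower A) : C.HomEquivPPPower A := by
  obtain ⟨I, _, _, h₁, h₂, hR⟩ := homEquivPPPower_iff.1 hBA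
  obtain ⟨J, _, _, g₁, g₂, hQ⟩ := homEquivPPPower_iff.1 hCB
  exact homEquivPPPower_iff.2
    ⟨J × I, inferInstance, inferInstance, _, _, fun k R => (hQ k R).trans hR⟩

theorem HomEquivPPPower.nonempty [Nonempty B] (h : B.HomEquivPPPower A) : Nonempty A := by
  obtain ⟨I, _, ⟨i⟩, h₁, -⟩ := homEquivPPPower_iff.1 h
  exact ⟨h₁ (Classical.arbitrary B) i⟩

open Classical in
theorem PPInterprets.homEquivPPPower [Nonempty B] (h : A.PPInterprets B) :
    B.HomEquivPPPower A := by
  obtain ⟨n, hn, f, hf, -, -, hR⟩ := h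
  choose g hg using hf
  refine homEquivPPPower_iff.2 ⟨Fin n, inferInstance, ⟨0, hn⟩, g,
    fun x => (f x).getOrElse (Classical.arbitrary B),
    fun k R => ⟨_, hR k R, fun b hb => ⟨b, fun i => hg (b i), hb⟩, ?_⟩⟩
  rintro x ⟨b, hb, hRb⟩
  have hfb (i : Fin k) : (f fun j => x (i, j)).getOrElse (Classical.arbitrary B) = b i := by
    obtain ⟨hdom, hi⟩ := hb i
    exact (Part.getOrElse_of_dom _ hdom _).trans hi
  simpa only [Set.mem_ofPred_eq, hfb] using hRb

theorem IsPPPower.ppInterprets [Nonempty A] (h : C.IsPPPower A) : A.PPInterprets C := by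
  obtain ⟨n, hn, e, he⟩ := h
  refine ⟨n, hn, fun x => Part.some (e x), fun c => ⟨e.symm c, by simp⟩, ?_, ?_, fun k R => ?_⟩
  · convert ppDefinable_univ (A := A) (ι := Fin n) using 1
    ext x
    simp
  · convert ppDefinable_forall fun j : Fin n =>
      ppDefinable_eq (A := A) ((0 : Fin 2), j) (1, j) using 1
    ext x
    simp [funext_iff]
  · convert he k R using 1
    ext x
    simp [← funext_iff]

theorem HomEquivPPPower.ppConstructs [Nonempty A] (h : B.HomEquivPPPower A) :
    A.PPConstructs B := by
  obtain ⟨C, hC, hBC⟩ := h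
  exact (Relation.ReflTransGen.single (.interpretation hC.ppInterprets)).tail (.homEquiv hBC.symm)

end PPPower

/-! ### Infinite systems of constraints over `ω`-categorical structures -/

/-- An atomic constraint over `A` with variables in `P`: a relation symbol of `A` applied to a
tuple of variables. -/
abbrev Constraint (A : RelStructure.{u, v, w}) (P : Type*) :=
  Σ k, A.L.Relations k × (Fin k → P)

/-- The assignments of elements of `A` to the variables that satisfy all constraints in `F`. -/
def solutions (A : RelStructure.{u, v, w}) {P : Type*} (F : Set (A.Constraint P)) : Set (P → A) :=
  {h | ∀ r ∈ F, RelMap r.2.1 fun i => h (r.2.2 i)}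

/-- Each finite part of the system `Φ` has a solution that agrees with `h` on `Q`. -/
def IsFinitelySolvable (A : RelStructure.{u, v, w}) {P : Type*} (Φ : Set (A.Constraint P))
    (Q : Finset P) (h : P → A) : Prop :=
  ∀ G ⊆ Φ, G.Finite → ∃ h' ∈ A.solutions G, ∀ q ∈ Q, h' q = h q

/-- A finite partial assignment that each finite part of the system `Φ` allows to extend to a
solution. The values of `map` outside `support` are irrelevant; `x ≤ y` means that `y` extends
`x`. -/
structure PartialSolution (A : RelStructure.{u, v, w}) {P : Type*} (Φ : Set (A.Constraint P)) where
  support : Finset P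
  map : P → A
  isFinitelySolvable : A.IsFinitelySolvable Φ support map

section Constraints

variable {A : RelStructure.{u, v, w}} {P : Type*} {Φ F G : Set (A.Constraint P)}

theorem solutions_anti (h : F ⊆ G) : A.solutions G ⊆ A.solutions F :=
  fun _ hf r hr => hf r (h hr)

theorem automorphism_comp_mem_solutions {h : P → A} (hh : h ∈ A.solutions F) (g : A ≃[A.L] A) :
    (fun p => g (h p)) ∈ A.solutions F :=
  fun r hr => (g.map_rel r.2.1 _).2 (hh r hr)

theorem OmegaCategorical.exists_orbit_representatives (hA : A.OmegaCategorical) (ι : Type*)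
    [Finite ι] : ∃ Y : Set (ι → A), Y.Finite ∧
      ∀ x : ι → A, ∃ y ∈ Y, ∃ g : A ≃[A.L] A, (fun i => g (y i)) = x := by
  obtain ⟨n, ⟨e⟩⟩ := Finite.exists_equiv_fin ι
  rcases Nat.eq_zero_or_pos n with rfl | hn
  · have : IsEmpty ι := e.isEmpty
    exact ⟨Set.univ, Set.toFinite _, fun x => ⟨x, trivial, .refl A.L A, rfl⟩⟩
  · obtain ⟨Y, hY, hYA⟩ := hA n hn
    refine ⟨(fun y i => y (e i)) '' Y, hY.image _, fun x => ?_⟩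
    obtain ⟨y, hy, g, hg⟩ := hYA fun i => x (e.symm i)
    exact ⟨_, ⟨y, hy, rfl⟩, g, funext fun i => by simp [hg]⟩

theorem OmegaCategorical.finite_setOf_invariant (hA : A.OmegaCategorical) (ι : Type*) [Finite ι] :
    {S : Set (ι → A) | ∀ x ∈ S, ∀ g : A ≃[A.L] A, (fun i => g (x i)) ∈ S}.Finite := by
  obtain ⟨Y, hY, hYA⟩ := hA.exists_orbit_representatives ι
  refine .of_injOn (f := (· ∩ Y)) (fun S _ => Set.inter_subset_right) ?_ hY.finite_subsets
  have subset_of_inter_eq {S T : Set (ι → A)} (hS : ∀ x ∈ S, ∀ g : A ≃[A.L] A,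
      (fun i => g (x i)) ∈ S) (hT : ∀ x ∈ T, ∀ g : A ≃[A.L] A, (fun i => g (x i)) ∈ T)
      (hST : S ∩ Y = T ∩ Y) : S ⊆ T := by
    intro x hx
    obtain ⟨y, hy, g, rfl⟩ := hYA x
    have hyS : y ∈ S := by simpa using hS _ hx g.symm
    exact hT y (hST ▸ ⟨hyS, hy⟩ : y ∈ T ∩ Y).1 g
  exact fun S hS T hT hST =>
    (subset_of_inter_eq hS hT hST).antisymm (subset_of_inter_eq hT hS hST.symm)

theorem OmegaCategorical.exists_finite_subset_image_solutions_subset (hA : A.OmegaCategorical)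
    (Φ : Set (A.Constraint P)) {ι : Type*} [Finite ι] (c : ι → P) :
    ∃ F ⊆ Φ, F.Finite ∧ ∀ G ⊆ Φ, G.Finite →
      (· ∘ c) '' A.solutions F ⊆ (· ∘ c) '' A.solutions G := by
  have hfin : ((fun F => (· ∘ c) '' A.solutions F) '' {F | F ⊆ Φ ∧ F.Finite}).Finite := by
    refine (hA.finite_setOf_invariant ι).subset ?_
    rintro _ ⟨F, -, rfl⟩ _ ⟨h, hh, rfl⟩ g
    exact ⟨_, automorphism_comp_mem_solutions hh g, rfl⟩
  obtain ⟨F, ⟨hFΦ, hF⟩, hmin⟩ :=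
    hfin.exists_minimalFor' _ _ ⟨∅, Set.empty_subset Φ, Set.finite_empty⟩
  refine ⟨F, hFΦ, hF, fun G hGΦ hG => ?_⟩
  calc (· ∘ c) '' A.solutions F
    _ ⊆ (· ∘ c) '' A.solutions (F ∪ G) :=
      hmin ⟨Set.union_subset hFΦ hGΦ, hF.union hG⟩
        (Set.image_mono (solutions_anti Set.subset_union_left))
    _ ⊆ (· ∘ c) '' A.solutions G := Set.image_mono (solutions_anti Set.subset_union_right)

theorem IsFinitelySolvable.extend (hA : A.OmegaCategorical) {Q : Finset P} {h : P → A}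
    (hh : A.IsFinitelySolvable Φ Q h) (Q' : Finset P) :
    ∃ h', (∀ q ∈ Q, h' q = h q) ∧ A.IsFinitelySolvable Φ Q' h' := by
  obtain ⟨F, hFΦ, hF, hFG⟩ :=
    hA.exists_finite_subset_image_solutions_subset Φ (Subtype.val : Q' → P)
  obtain ⟨h', hh', hQ⟩ := hh F hFΦ hF
  refine ⟨h', hQ, fun G hGΦ hG => ?_⟩
  obtain ⟨f, hf, hfh'⟩ := hFG G hGΦ hG ⟨h', hh', rfl⟩
  exact ⟨f, hf, fun q hq => congrFun hfh' ⟨q, hq⟩⟩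

instance : Preorder (PartialSolution A Φ) where
  le x y := x.support ⊆ y.support ∧ ∀ p ∈ x.support, y.map p = x.map p
  le_refl _ := ⟨subset_rfl, fun _ _ => rfl⟩
  le_trans _ _ _ hxy hyz :=
    ⟨hxy.1.trans hyz.1, fun p hp => (hyz.2 p (hxy.1 hp)).trans (hxy.2 p hp)⟩

theorem PartialSolution.isCofinal_setOf_subset_support (hA : A.OmegaCategorical) (Q : Finset P) :
    IsCofinal {x : PartialSolution A Φ | Q ⊆ x.support} := by
  classical
  intro x
  obtain ⟨h, hhx, hh⟩ := x.isFinitelySolvable.extend hA (Q ∪ x.support)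
  exact ⟨⟨_, h, hh⟩, Finset.subset_union_left, Finset.subset_union_right, hhx⟩

/-- The Rasiowa–Sikorski lemma glues a generic chain of finite partial solutions. -/
theorem PartialSolution.exists_solution [Countable P] (hA : A.OmegaCategorical)
    (x : PartialSolution A Φ) : ∃ f ∈ A.solutions Φ, ∀ p ∈ x.support, f p = x.map p := by
  let _ := Encodable.ofCountable (Finset P)
  let 𝒟 (Q : Finset P) : Order.Cofinal (PartialSolution A Φ) :=
    ⟨_, isCofinal_setOf_subset_support hA Q⟩
  let J := Order.idealOfCofinals x 𝒟
  choose y hyQ hyJ using Order.cofinal_meets_idealOfCofinals x 𝒟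
  let f (p : P) : A := (y {p}).map p
  have hf {z : PartialSolution A Φ} (hz : z ∈ J) {p : P} (hp : p ∈ z.support) :
      f p = z.map p := by
    obtain ⟨t, -, hyt, hzt⟩ := J.directed _ (hyJ {p}) z hz
    exact (hyt.2 p (hyQ {p} (Finset.mem_singleton_self p))).symm.trans (hzt.2 p hp)
  refine ⟨f, fun r hr => ?_, fun p => hf (Order.mem_idealOfCofinals x 𝒟)⟩
  classical
  let Q := Finset.univ.image r.2.2
  obtain ⟨h, hh, hhy⟩ := (y Q).isFinitelySolvable {r} (Set.singleton_subset_iff.2 hr)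
    (Set.finite_singleton r)
  have hfh (i) : f (r.2.2 i) = h (r.2.2 i) := by
    have hi : r.2.2 i ∈ (y Q).support :=
      hyQ Q (Finset.mem_image_of_mem _ (Finset.mem_univ i))
    exact (hf (hyJ Q) hi).trans (hhy _ hi).symm
  simpa only [hfh] using hh r rfl

theorem ppDefinable_image_solutions_of_finite [Nonempty A] (hF : F.Finite) {ι : Type} [Finite ι]
    (c : ι → P) : A.PPDefinable ((· ∘ c) '' A.solutions F) := by
  induction F, hF using Set.Finite.induction_on generalizing ι with
  | empty =>
    convert ppDefinable_forall fun p : {p : ι × ι // c p.1 = c p.2} =>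
      ppDefinable_eq (A := A) p.1.1 p.1.2 using 1
    ext x
    calc x ∈ (· ∘ c) '' A.solutions ∅
      _ ↔ ∃ h : P → A, x = h ∘ c := by simp [solutions, eq_comm]
      _ ↔ x.FactorsThrough c := (Function.factorsThrough_iff x).symm
      _ ↔ _ := ⟨fun h p => h p.2, fun h i j hij => h ⟨(i, j), hij⟩⟩
  | @insert r F _ _ ih =>
    convert ((ih (Sum.elim c r.2.2)).inter (ppDefinable_rel r.2.1 Sum.inr)).exists using 1
    ext x
    constructor
    · rintro ⟨h, hh, rfl⟩
      refine ⟨h ∘ r.2.2, ⟨h, solutions_anti (Set.subset_insert r F) hh, ?_⟩, hh r (.inl rfl)⟩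
      exact Sum.comp_elim h c r.2.2
    · rintro ⟨y, ⟨h, hh, hxy⟩, hy⟩
      obtain ⟨rfl, rfl⟩ : h ∘ c = x ∧ h ∘ r.2.2 = y := by
        simpa [Sum.comp_elim, Sum.elim_eq_iff] using hxy
      exact ⟨h, Set.forall_mem_insert.2 ⟨hy, hh⟩, rfl⟩

theorem OmegaCategorical.ppDefinable_image_solutions [Nonempty A] [Countable P]
    (hA : A.OmegaCategorical) (Φ : Set (A.Constraint P)) {ι : Type} [Finite ι] (c : ι → P) :
    A.PPDefinable ((· ∘ c) '' A.solutions Φ) := by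
  obtain ⟨F, hFΦ, hF, hFG⟩ := hA.exists_finite_subset_image_solutions_subset Φ c
  convert ppDefinable_image_solutions_of_finite hF c using 1
  refine (Set.image_mono (solutions_anti hFΦ)).antisymm ?_
  rintro _ ⟨h, hh, rfl⟩
  let x : PartialSolution A Φ := ⟨(Set.finite_range c).toFinset, h, fun G hGΦ hG => by
    obtain ⟨h', hh', hc⟩ := hFG G hGΦ hG ⟨h, hh, rfl⟩
    exact ⟨h', hh', by simpa using congrFun hc⟩⟩
  obtain ⟨f, hf, hfx⟩ := x.exists_solution hA
  exact ⟨f, hf, funext fun i => hfx _ (by simp [x])⟩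

theorem pol_ops_eq_solutions (A : RelStructure.{u, v, w}) (n : ℕ+) :
    A.Pol.ops n = A.solutions {r : A.Constraint (Fin n → A) |
      ∀ j, RelMap r.2.1 fun i => r.2.2 i j} :=
  Set.ext fun _ => ⟨fun hf r hr => hf r.1 r.2.1 (fun j i => r.2.2 i j) hr,
    fun hf k R t ht => hf ⟨k, R, fun i j => t j i⟩ ht⟩

theorem OmegaCategorical.ppDefinable_image_pol [Nonempty A] [Countable A]
    (hA : A.OmegaCategorical) {n : ℕ+} {ι : Type} [Finite ι] (t : Fin n → ι → A) :
    A.PPDefinable ((fun f j => f fun i => t i j) '' A.Pol.ops n) :=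
  pol_ops_eq_solutions A n ▸ hA.ppDefinable_image_solutions _ fun j i => t i j

end Constraints

/-! ### Adding a constant to a model-complete core -/

section AddSingleton

variable {C : RelStructure.{u, v, w}}

theorem IsModelCompleteCore.exists_automorphism_eq (hcore : C.IsModelCompleteCore)
    {f : (Fin (1 : ℕ+) → C) → C} (hf : f ∈ C.Pol.ops 1) (s : C) :
    ∃ g : C ≃[C.L] C, g s = f fun _ => s := by
  let e : C →[C.L] C :=
    ⟨fun x => f fun _ => x, fun f => isEmptyElim f, fun R x hx => hf _ R (fun _ => x) fun _ => hx⟩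
  obtain ⟨g, hg⟩ := hcore e {s} (Set.finite_singleton s)
  exact ⟨g, hg s rfl⟩

theorem IsModelCompleteCore.ppDefinable_orbit [Countable C] (hcore : C.IsModelCompleteCore)
    (hC : C.OmegaCategorical) (s : C) :
    C.PPDefinable {x : Unit → C | ∃ g : C ≃[C.L] C, g s = x ()} := by
  have : Nonempty C := ⟨s⟩
  convert hC.ppDefinable_image_pol (n := 1) fun _ (_ : Unit) => s using 1
  ext x
  constructor
  · rintro ⟨g, hg⟩
    exact ⟨fun y => g (y 0), fun _ R t ht => (g.map_rel R (t 0)).2 (ht 0), funext fun _ => hg⟩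
  · rintro ⟨f, hf, rfl⟩
    exact hcore.exists_automorphism_eq hf s

/-- The constant `s` is encoded by a second coordinate that ranges over the orbit of `s`: an
element `b` becomes `(b, s)`, and a pair `(x, y)` with `y` in the orbit of `s` is decoded by an
automorphism that moves `y` to `s`. -/
theorem addSingleton_homEquivPPPower [Countable C] (hC : C.OmegaCategorical)
    (hcore : C.IsModelCompleteCore) (s : C) : (C.addSingleton s).HomEquivPPPower C := by
  have : Nonempty C := ⟨s⟩
  have exists_automorphism (y : C) : ∃ g : C ≃[C.L] C, (∃ h : C ≃[C.L] C, h s = y) → g y = s := by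
    by_cases hy : ∃ h : C ≃[C.L] C, h s = y
    · obtain ⟨h, rfl⟩ := hy
      exact ⟨h.symm, fun _ => h.symm_apply_apply s⟩
    · exact ⟨.refl C.L C, fun hy' => absurd hy' hy⟩
  choose g hg using exists_automorphism
  refine homEquivPPPower_iff.2 ⟨Fin 2, inferInstance, inferInstance, fun b => ![b, s],
    fun x => g (x 1) (x 0), ?_⟩
  rintro k (R | ⟨⟨⟩⟩)
  · refine ⟨{x | RelMap R fun i => x (i, 0)} ∩ {x | ∀ p : Fin k × Fin k, x (p.1, 1) = x (p.2, 1)},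
      (ppDefinable_rel R _).inter (ppDefinable_forall fun p => ppDefinable_eq _ _),
      fun x hx => ⟨hx, fun _ => rfl⟩, ?_⟩
    rintro y ⟨hR, hy⟩
    change RelMap R fun i => g (y (i, 1)) (y (i, 0))
    cases k with
    | zero => rwa [Subsingleton.elim (fun i => g (y (i, 1)) (y (i, 0))) fun i => y (i, 0)]
    | succ k =>
      have hg0 (i) : g (y (i, 1)) = g (y (0, 1)) := congrArg g (hy (i, 0))
      simpa only [hg0, Function.comp_def] using ((g (y (0, 1))).map_rel R _).2 hR
  · refine ⟨{x | x (0, 0) = x (0, 1)} ∩ {x | ∃ h : C ≃[C.L] C, h s = x (0, 1)},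
      (ppDefinable_eq _ _).inter ((hcore.ppDefinable_orbit hC s).preimage fun _ => (0, 1)),
      fun x hx => ⟨hx, .refl C.L C, rfl⟩, ?_⟩
    rintro y ⟨hy, hs⟩
    exact (congrArg (g (y (0, 1))) hy).trans (hg _ hs)

theorem PPStep.homEquivPPPower {D : RelStructure.{u, v, w}} [Nonempty D] (h : PPStep C D) :
    D.HomEquivPPPower C := by
  cases h with
  | interpretation h => exact h.homEquivPPPower
  | homEquiv h => exact .of_homEquiv h
  | singleton s _ hC hcore => exact addSingleton_homEquivPPPower hC hcore s

theorem PPConstructs.homEquivPPPower {A B : RelStructure.{u, v, w}} [Nonempty B]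
    (h : A.PPConstructs B) : B.HomEquivPPPower A := by
  induction h using Relation.ReflTransGen.head_induction_on with
  | refl => exact .refl B
  | head h _ ih =>
    have := ih.nonempty
    have := h.homEquivPPPower.nonempty
    exact ih.trans h.homEquivPPPower

end AddSingleton

end RelStructure

/-! ### Reflections of finite powers -/

/-- The maps `h₁ : Y → X ^ I` and `h₂ : X ^ I → Y` reflect the operations on `X ^ I` induced by
`F` to operations in `G`, where `X` and `Y` are the domains of `F` and `G`. -/
def FunctionSet.ReflectsInto (F G : FunctionSet.{u}) {I : Type} (h₁ : G.dom → I → F.dom)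
    (h₂ : (I → F.dom) → G.dom) : Prop :=
  ∀ n : ℕ+, ∀ f ∈ F.ops n, (fun x => h₂ fun j => f fun i => h₁ (x i) j) ∈ G.ops n

theorem FunctionSet.mem_expansions_reflections_finitePowers_iff {F G : FunctionSet.{u}} :
    G ∈ expansions (reflections (finitePowers {F})) ↔
      ∃ (I : Type) (_ : Finite I) (h₁ : G.dom → I → F.dom) (h₂ : (I → F.dom) → G.dom),
        F.ReflectsInto G h₁ h₂ := by
  constructor
  · rintro ⟨R, ⟨P, ⟨_, rfl, m, e, hP⟩, h₁, h₂, hR⟩, e', hG⟩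
    refine ⟨Fin m, inferInstance, fun y => e.symm (h₁ (e'.symm y)), fun x => e' (h₂ (e x)),
      fun n f hf => hG n (fun x => h₂ (e fun j => f fun i => e.symm (h₁ (x i)) j)) ?_⟩
    rw [hR]
    refine ⟨fun x => e fun j => f fun i => e.symm (x i) j, ?_, rfl⟩
    rw [hP]
    exact ⟨_, ⟨f, hf, rfl⟩, rfl⟩
  · rintro ⟨I, _, h₁, h₂, h⟩
    obtain ⟨m, ⟨e⟩⟩ := Finite.exists_equiv_fin I
    have power_mem : F.power m ∈ finitePowers {F} :=
      ⟨F, rfl, m, .refl _, fun n => by simp⟩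
    refine ⟨⟨G.dom, fun n => {g | ∃ f ∈ (F.power m).ops n, g = fun x => h₂ fun i =>
      f (fun l j => h₁ (x l) (e.symm j)) (e i)}⟩, ⟨_, power_mem, fun y j => h₁ y (e.symm j),
        fun x => h₂ fun i => x (e i), fun n => rfl⟩, .refl _, ?_⟩
    rintro n _ ⟨_, ⟨f, hf, rfl⟩, rfl⟩
    simpa using h n f hf

theorem FunctionClone.exists_isH1Hom_isUniformlyContinuous_of_reflectsInto
    {C D : FunctionClone.{u}} {I : Type} [Finite I] {h₁ : D.dom → I → C.dom}
    {h₂ : (I → C.dom) → D.dom} (h : C.ReflectsInto D.toFunctionSet h₁ h₂) :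
    ∃ ξ : ArityMap C D, IsH1Hom ξ ∧ IsUniformlyContinuous ξ := by
  refine ⟨fun n f => ⟨_, h n f.1 f.2⟩, fun n m σ f => rfl, fun T hT =>
    ⟨⋃ y ∈ T, Set.range (h₁ y), hT.biUnion fun y _ => Set.finite_range _, fun n f g hfg x hx => ?_⟩⟩
  exact congrArg h₂ (funext fun j => hfg _ fun i => Set.mem_biUnion (hx i) ⟨j, rfl⟩)

/-- The value of `ξ f` at an enumeration of `D` is determined by the values of `f` on a finite
set; as `ξ` respects identifications of variables, it determines every `ξ f`. -/
theorem FunctionClone.IsH1Hom.exists_reflectsInto {C D : FunctionClone.{u}} [Nonempty C.dom]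
    [Finite D.dom] [Nonempty D.dom] {ξ : ArityMap C D} (hξ : IsH1Hom ξ)
    (hξ_cont : IsUniformlyContinuous ξ) :
    ∃ (I : Type) (_ : Finite I) (_ : Nonempty I) (h₁ : D.dom → I → C.dom)
      (h₂ : (I → C.dom) → D.dom), C.ReflectsInto D.toFunctionSet h₁ h₂ := by
  obtain ⟨S, hS, hξS⟩ := hξ_cont Set.univ Set.finite_univ
  obtain ⟨M, a, -, ha⟩ := (hS.insert (Classical.arbitrary C.dom)).fin_param
  obtain ⟨n, ⟨e⟩⟩ := Finite.exists_equiv_fin D.dom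
  lift n to ℕ+ using Fin.pos (e (Classical.arbitrary D.dom))
  let table (f : C.ops n) (i : Fin n → Fin M) : C.dom := f.1 fun l => a (i l)
  let value (f : C.ops n) : D.dom := (ξ n f).1 e.symm
  have hvalue : value.FactorsThrough table := fun f g hfg => by
    refine hξS n f g (fun x hx => ?_) _ fun _ => trivial
    choose i hi using fun l => (ha.symm ▸ Set.mem_insert_of_mem _ (hx l) : x l ∈ Set.range a)
    simpa only [table, hi] using congrFun hfg i
  obtain ⟨i₀, -⟩ : Classical.arbitrary C.dom ∈ Set.range a := ha ▸ Set.mem_insert _ _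
  refine ⟨Fin n → Fin M, inferInstance, ⟨fun _ => i₀⟩, fun y i => a (i (e y)),
    Function.extend table value fun _ => Classical.arbitrary D.dom, fun m f hf => ?_⟩
  convert (ξ m ⟨f, hf⟩).2 using 1
  ext x
  calc Function.extend table value _ (table (C.comp ⟨f, hf⟩ fun l => C.proj n (e (x l))))
    _ = (ξ n (C.comp ⟨f, hf⟩ fun l => C.proj n (e (x l)))).1 e.symm := hvalue.extend_apply _ _
    _ = (ξ m ⟨f, hf⟩).1 fun l => e.symm (e (x l)) := by
      rw [hξ]
      rfl
    _ = (ξ m ⟨f, hf⟩).1 x := by simp only [Equiv.symm_apply_apply]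

namespace RelStructure

section Pol

variable {A B : RelStructure.{u, v, w}}

theorem reflectsInto_pol_of_ppRepresents {I : Type} {h₁ : B → I → A} {h₂ : (I → A) → B}
    (hB : ∀ (k : ℕ) (R : B.L.Relations k), A.PPRepresents h₁ h₂ {x | RelMap R x}) :
    A.Pol.ReflectsInto B.Pol.toFunctionSet h₁ h₂ := by
  intro n f hf k R t ht
  obtain ⟨S', hS', hto, hof⟩ := hB k R
  exact hof _ (hS'.preserves_pol n f hf _ fun i => hto _ (ht i))

theorem OmegaCategorical.ppRepresents_of_preserves [Nonempty A] [Countable A]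
    (hA : A.OmegaCategorical) {G : FunctionSet.{u}} {I : Type} [Finite I] {h₁ : G.dom → I → A}
    {h₂ : (I → A) → G.dom} (hG : A.Pol.ReflectsInto G h₁ h₂) {ι : Type} [Finite ι]
    {S : Set (ι → G.dom)} (hS : S.Finite) (hS_nonempty : S.Nonempty) (hGS : G.Preserves S) :
    A.PPRepresents h₁ h₂ S := by
  obtain ⟨n, s, -, rfl⟩ := hS.fin_param
  obtain ⟨_, i₀, -⟩ := hS_nonempty
  lift n to ℕ+ using Fin.pos i₀
  refine ⟨_, hA.ppDefinable_image_pol fun i (p : ι × I) => h₁ (s i p.1) p.2, ?_, ?_⟩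
  · rintro _ ⟨i, rfl⟩
    exact ⟨_, A.Pol.proj_mem n i, rfl⟩
  · rintro _ ⟨f, hf, rfl⟩
    exact hGS n _ (hG n f hf) s fun i => ⟨i, rfl⟩

theorem OmegaCategorical.homEquivPPPower_of_isH1Hom [Nonempty A] [Countable A]
    (hA : A.OmegaCategorical) [Finite B] [Nonempty B]
    (hB : (∀ (k : ℕ) (R : B.L.Relations k), ∃ x : Fin k → B, RelMap R x) ∨
      A.PPDefinable (∅ : Set (Fin 1 → A)))
    {ξ : FunctionClone.ArityMap A.Pol B.Pol} (hξ : FunctionClone.IsH1Hom ξ)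
    (hξ_cont : FunctionClone.IsUniformlyContinuous ξ) : B.HomEquivPPPower A := by
  have : Nonempty A.Pol.dom := ‹Nonempty A›
  have : Nonempty B.Pol.dom := ‹Nonempty B›
  have : Finite B.Pol.dom := ‹Finite B›
  obtain ⟨I, _, _, h₁, h₂, h⟩ := hξ.exists_reflectsInto hξ_cont
  refine homEquivPPPower_iff.2 ⟨I, inferInstance, inferInstance, h₁, h₂, fun k R => ?_⟩
  rcases {x : Fin k → B | RelMap R x}.eq_empty_or_nonempty with hR | hR
  · have hempty := hB.resolve_left fun hne => (hne k R).elim fun x hx => hR.subset hx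
    rw [hR]
    exact ⟨∅, hempty.empty, fun x hx => hx.elim, fun y hy => hy.elim⟩
  · exact hA.ppRepresents_of_preserves h (Set.toFinite _) hR fun n f hf => hf k R

end Pol

end RelStructure

theorem theorem1p5 (A B : RelStructure.{u, v, w}) [Nonempty A] [Nonempty B]
    [Countable A] (hA : A.OmegaCategorical) [Finite B]
    (hB : (∀ (k : ℕ) (R : B.L.Relations k), ∃ x : Fin k → B, RelMap R x) ∨
      A.PPDefinable (∅ : Set (Fin 1 → A))) :
    List.TFAE [
      ∃ C : RelStructure.{u, v, w}, C.IsPPPower A ∧ B.HomEquiv C,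
      A.PPConstructs B,
      B.Pol.toFunctionSet ∈ FunctionSet.expansions
        (FunctionSet.reflections (FunctionSet.finitePowers {A.Pol.toFunctionSet})),
      ∃ ξ : FunctionClone.ArityMap A.Pol B.Pol,
        FunctionClone.IsH1Hom ξ ∧ FunctionClone.IsUniformlyContinuous ξ] := by
  tfae_have 1 → 2 := RelStructure.HomEquivPPPower.ppConstructs
  tfae_have 2 → 1 := RelStructure.PPConstructs.homEquivPPPower
  tfae_have 1 → 3 := fun h => by
    obtain ⟨I, _, _, h₁, h₂, hR⟩ := RelStructure.homEquivPPPower_iff.1 h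
    exact FunctionSet.mem_expansions_reflections_finitePowers_iff.2
      ⟨I, inferInstance, h₁, h₂, RelStructure.reflectsInto_pol_of_ppRepresents hR⟩
  tfae_have 3 → 4 := fun h => by
    obtain ⟨I, _, h₁, h₂, hR⟩ := FunctionSet.mem_expansions_reflections_finitePowers_iff.1 h
    exact FunctionClone.exists_isH1Hom_isUniformlyContinuous_of_reflectsInto hR
  tfae_have 4 → 1 := fun ⟨_, hξ, hξ_cont⟩ => hA.homEquivPPPower_of_isH1Hom hB hξ hξ_cont
  tfae_finish
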